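/- Let $d\ge 1$, let $X_1,X_2,\dots$ be i.i.d. $\mathbb{Z}^d$-valued random variables (with arbitrary common law), let $a\in\mathbb{Z}^d$, and let $S_k=a+\sum_{i=1}^k X_i$, $k\ge 0$, be the random walk started from $a$. For $z\in\mathbb{Z}^d$ let $\mathcal N(z)$ be the set of the $2d$ lattice points at Euclidean distance $1$ from $z$. Let $$L_n=\#\{S_i : 0\le i\le n,\ \mathcal N(S_i)\not\subset\{S_m\}_{m=0}^n\}$$ be the number of inner boundary points of the range $\{S_m\}_{m=0}^n$. Then $$\lim_{n\to\infty}\frac{L_n}{n}=q\quad\text{almost surely},$$ where $$q=P\Big(\mathcal N(0)\not\subset\{S^0_m\}_{m=0}^\infty\cup\{S'_m\}_{m=0}^\infty\ \text{ and }\ 0\notin\{S^0_m\}_{m=1}^\infty\Big),$$ $S^0_k=\sum_{i=1}^k X_i$ is the walk started from $0$, and $\{S'_m\}_{m\ge 0}$ is a copy of $\{-S^0_m\}_{m\ge 0}$ independent of $\{S^0_m\}_{m\ge 0}$. -/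

import Mathlib

open MeasureTheory ProbabilityTheory Filter Topology

namespace RangeBoundary

/-- The neighbours of `a` in the lattice `ℤ^d`: the points at (`ℓ¹`, equivalently Euclidean)
distance one from `a`. The metric that Mathlib puts on `Fin d → ℤ` is the sup metric, which is
not the one meant here. -/
def neighbors {d : ℕ} (a : Fin d → ℤ) : Set (Fin d → ℤ) :=
  {z | ∑ i, |z i - a i| = 1}

/-- The walk `S_k = a + X_1 + ⋯ + X_k` started from `a`, as a path; the increment `X_{i+1}` is
`x i`. -/
def walk {d : ℕ} (a : Fin d → ℤ) (x : ℕ → Fin d → ℤ) (k : ℕ) : Fin d → ℤ :=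
  a + ∑ i ∈ Finset.range k, x i

/-- The inner boundary `H_n` of the range `{S_0, …, S_n}` of a path `S`. -/
def innerBoundary {d : ℕ} (S : ℕ → Fin d → ℤ) (n : ℕ) : Set (Fin d → ℤ) :=
  {z | ∃ i ≤ n, z = S i ∧ ¬ neighbors (S i) ⊆ S '' {m | m ≤ n}}

/-- The number `L_n` of points of the inner boundary (a finite set). -/
noncomputable def boundaryCount {d : ℕ} (S : ℕ → Fin d → ℤ) (n : ℕ) : ℕ :=
  (innerBoundary S n).ncard

/-- The pairs of paths `(S, S')` such that `{S_m : m ≥ 0} ∪ {S'_m : m ≥ 0}` does not contain all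
neighbours of the origin and `S` is not at the origin at any time `m ≥ 1`. -/
def escapeEvent (d : ℕ) : Set ((ℕ → Fin d → ℤ) × (ℕ → Fin d → ℤ)) :=
  {p | ¬ neighbors 0 ⊆ Set.range p.1 ∪ Set.range p.2 ∧ ∀ m, 1 ≤ m → p.1 m ≠ 0}

/-- The constant `q`: the probability of `escapeEvent` for the pair `(S, S')`, where `S` is the
walk started from the origin with increments `X` and `S'` is an independent copy of `-S`; that is,
the law of the pair is the product of the law of `S` and the law of `-S` on path space. -/
noncomputable def boundaryRate {d : ℕ} {Ω : Type*} [MeasurableSpace Ω] (P : Measure Ω)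
    (X : ℕ → Ω → Fin d → ℤ) : ℝ :=
  ((P.map fun ω k => walk 0 (fun i => X i ω) k).prod
    (P.map fun ω k => -walk 0 (fun i => X i ω) k)).real (escapeEvent d)

end RangeBoundary

namespace RangeBoundary

/-! Each inner boundary point is counted at its last visit up to time `n`. Near such a time `s + K`,
look only at the walk in the window `[s, s + 2K]`: `windowEvent` asks that the centre is not
revisited later in the window and that some neighbour is missed throughout it. Up to `2K` end terms,
`L_n` is at most the number of such windows (`boundaryCount_le`). A window depends on `2K`
increments, so the strong law along residue classes gives its frequency (`tendsto_card_shift_mem`).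
Read outwards from its centre, it is a pair of independent walks, the backward one negated, so its
probability decreases to `q` as `K → ∞` (`tendsto_measureReal_windowEvent`).

For the lower bound, a window yields no boundary point only if the walk comes back near its centre
after a gap longer than `K`; such failures are bounded by a multiple of the number of `lateVisit`
times (`card_windowEvent_le`). If `q = 0` nothing is needed. If `q > 0`, the walk has a positive
chance of never returning, hence is transient by the last exit decomposition, and `lateVisit` has
probability tending to `0`. It depends on infinitely many increments, so its frequency is controlled
by the maximal ergodic inequality (`measure_exists_card_visits_le`) instead of the strong law. -/

/-! ### Maximal ergodic inequality for visits to a set -/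

open Classical in
/-- Covering lemma: if every point of `B` starts a block of length at most `T` in which `G` has
density at least `c`, then `B` has at most `c⁻¹` times as many points as `G`. -/
lemma covering (G B : ℕ → Prop) (c : ℝ) (hc : 0 ≤ c) (T : ℕ)
    (hB : ∀ i, B i → ∃ n, 1 ≤ n ∧ n ≤ T ∧
      c * n ≤ ((Finset.Ico i (i + n)).filter G).card) (L : ℕ) :
    ∀ p, c * ((Finset.Ico p (p + L)).filter B).card ≤
      ((Finset.Ico p (p + L + T)).filter G).card := by
  induction L using Nat.strong_induction_on with
  | _ L ih =>
  intro p
  rcases Nat.eq_zero_or_pos L with rfl | hL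
  · simp
  -- Greedy covering: jump over the whole block if `p` starts one, otherwise advance by one.
  by_cases hp : B p
  · obtain ⟨n, h1, hT, hn⟩ := hB p hp
    by_cases hnL : n ≤ L
    · have h := ih (L - n) (by omega) (p + n)
      have e : p + n + (L - n) = p + L := by omega
      rw [e] at h
      have hb : ((Finset.Ico p (p + L)).filter B).card ≤
          n + ((Finset.Ico (p + n) (p + L)).filter B).card := by
        rw [← Finset.Ico_union_Ico_eq_Ico (Nat.le_add_right p n) (by omega : p + n ≤ p + L),
          Finset.filter_union]
        refine (Finset.card_union_le _ _).trans (Nat.add_le_add_right ?_ _)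
        exact (Finset.card_filter_le _ _).trans (by simp)
      have hg : ((Finset.Ico p (p + n)).filter G).card +
          ((Finset.Ico (p + n) (p + L + T)).filter G).card =
          ((Finset.Ico p (p + L + T)).filter G).card := by
        rw [← Finset.Ico_union_Ico_eq_Ico (Nat.le_add_right p n)
          (by omega : p + n ≤ p + L + T), Finset.filter_union, Finset.card_union_of_disjoint]
        exact Finset.disjoint_filter_filter (Finset.Ico_disjoint_Ico_consecutive _ _ _)
      have hb' : (((Finset.Ico p (p + L)).filter B).card : ℝ) ≤
          n + ((Finset.Ico (p + n) (p + L)).filter B).card := by exact_mod_cast hb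
      have hg' : (((Finset.Ico p (p + n)).filter G).card : ℝ) +
          ((Finset.Ico (p + n) (p + L + T)).filter G).card =
          ((Finset.Ico p (p + L + T)).filter G).card := by exact_mod_cast hg
      nlinarith [mul_le_mul_of_nonneg_left hb' hc]
    -- The last block may overshoot `p + L`, but by at most `T`; this is why the right side has the
    -- margin `T`.
    · have hb : (((Finset.Ico p (p + L)).filter B).card : ℝ) ≤ n := by
        have := (Finset.card_filter_le (Finset.Ico p (p + L)) B).trans (by simp : _ ≤ L)
        exact_mod_cast this.trans (by omega)
      have hg : (((Finset.Ico p (p + n)).filter G).card : ℝ) ≤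
          ((Finset.Ico p (p + L + T)).filter G).card := by
        exact_mod_cast Finset.card_le_card
          (Finset.filter_subset_filter _ (Finset.Ico_subset_Ico le_rfl (by omega)))
      exact (mul_le_mul_of_nonneg_left hb hc).trans (hn.trans hg)
  · have h := ih (L - 1) (by omega) (p + 1)
    have e : p + 1 + (L - 1) = p + L := by omega
    rw [e] at h
    have hb : (Finset.Ico p (p + L)).filter B = (Finset.Ico (p + 1) (p + L)).filter B := by
      rw [← Finset.insert_Ico_add_one_left_eq_Ico (by omega : p < p + L), Finset.filter_insert,
        if_neg hp]
    rw [hb]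
    refine h.trans ?_
    exact_mod_cast Finset.card_le_card
      (Finset.filter_subset_filter _ (Finset.Ico_subset_Ico (by omega) le_rfl))

open Classical in
lemma integral_card_visits {α : Type*} [MeasurableSpace α] {μ : Measure α}
    [IsProbabilityMeasure μ] {f : α → α} (hf : MeasurePreserving f μ μ) {G : Set α}
    (hG : MeasurableSet G) (L : ℕ) :
    Integrable (fun x => (((Finset.Ico 0 L).filter fun j => f^[j] x ∈ G).card : ℝ)) μ ∧
    ∫ x, (((Finset.Ico 0 L).filter fun j => f^[j] x ∈ G).card : ℝ) ∂μ = L * μ.real G := by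
  have e : (fun x => (((Finset.Ico 0 L).filter fun j => f^[j] x ∈ G).card : ℝ)) =
      fun x => ∑ j ∈ Finset.Ico 0 L, ((f^[j]) ⁻¹' G).indicator (fun _ => (1 : ℝ)) x := by
    ext x
    simp [Set.indicator_apply]
  have hi : ∀ j, Integrable (((f^[j]) ⁻¹' G).indicator (fun _ => (1 : ℝ))) μ := fun j =>
    (integrable_const _).indicator ((hf.iterate j).measurable hG)
  rw [e]
  refine ⟨integrable_finsetSum _ fun j _ => hi j, ?_⟩
  rw [integral_finsetSum _ fun j _ => hi j]
  have : ∀ j, ∫ x, ((f^[j]) ⁻¹' G).indicator (fun _ => (1 : ℝ)) x ∂μ = μ.real G := by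
    intro j
    rw [integral_indicator_const _ ((hf.iterate j).measurable hG), smul_eq_mul, mul_one,
      measureReal_def, (hf.iterate j).measure_preimage hG.nullMeasurableSet, measureReal_def]
  simp [this]

open Classical in
/-- The event that, at some time `n ≤ T`, more than a fraction `c` of the first `n` points of the
orbit have been in `G`. -/
def denseVisits {α : Type*} (f : α → α) (G : Set α) (c : ℝ) (T : ℕ) : Set α :=
  {x | ∃ n, 1 ≤ n ∧ n ≤ T ∧ c * n < ((Finset.Ico 0 n).filter fun j => f^[j] x ∈ G).card}

open Classical in
lemma measurable_card_visits {α : Type*} [MeasurableSpace α] {f : α → α} (hf : Measurable f)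
    {G : Set α} (hG : MeasurableSet G) (n : ℕ) :
    Measurable fun x => (((Finset.Ico 0 n).filter fun j => f^[j] x ∈ G).card : ℝ) := by
  have e : (fun x => (((Finset.Ico 0 n).filter fun j => f^[j] x ∈ G).card : ℝ)) =
      fun x => ∑ j ∈ Finset.Ico 0 n, ((f^[j]) ⁻¹' G).indicator (fun _ => (1 : ℝ)) x := by
    ext x
    simp [Set.indicator_apply]
  rw [e]
  exact Finset.measurable_sum _ fun j _ => measurable_const.indicator ((hf.iterate j) hG)

open Classical in
lemma measurableSet_denseVisits {α : Type*} [MeasurableSpace α] {f : α → α} (hf : Measurable f)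
    {G : Set α} (hG : MeasurableSet G) (c : ℝ) (T : ℕ) :
    MeasurableSet (denseVisits f G c T) := by
  have : denseVisits f G c T = ⋃ n, ⋃ (_ : 1 ≤ n ∧ n ≤ T), {x | c * n <
      ((Finset.Ico 0 n).filter fun j => f^[j] x ∈ G).card} := by
    ext x; simp [denseVisits, and_assoc]
  rw [this]
  exact MeasurableSet.iUnion fun n => MeasurableSet.iUnion fun _ =>
    measurableSet_lt measurable_const (measurable_card_visits hf hG n)

/-- Integrating the covering bound over orbit segments of length `L` gives, by invariance, `c L μ(E)
≤ (L + T) μ(G)`; divide by `L` and let `L → ∞`. -/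
lemma measureReal_denseVisits_le {α : Type*} [MeasurableSpace α] {μ : Measure α}
    [IsProbabilityMeasure μ] {f : α → α} (hf : MeasurePreserving f μ μ) {G : Set α}
    (hG : MeasurableSet G) {c : ℝ} (hc : 0 ≤ c) (T : ℕ) :
    c * μ.real (denseVisits f G c T) ≤ μ.real G := by
  classical
  set E := denseVisits f G c T with hE
  have hEm : MeasurableSet E := measurableSet_denseVisits hf.measurable hG c T
  have key : ∀ L : ℕ, c * (L * μ.real E) ≤ ((L + T : ℕ) : ℝ) * μ.real G := by
    intro L
    rw [← (integral_card_visits hf hEm L).2, ← (integral_card_visits hf hG (L + T)).2,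
      ← integral_const_mul]
    refine integral_mono ((integral_card_visits hf hEm L).1.const_mul c)
      (integral_card_visits hf hG (L + T)).1 fun x => ?_
    have := covering (fun j => f^[j] x ∈ G) (fun j => f^[j] x ∈ E) c hc T ?_ L 0
    · simpa using this
    · rintro i ⟨n, h1, h2, h3⟩
      refine ⟨n, h1, h2, h3.le.trans_eq ?_⟩
      norm_cast
      refine Finset.card_bij (fun j _ => i + j) ?_ ?_ ?_
      · intro j hj
        simp only [Finset.mem_filter, Finset.mem_Ico] at hj ⊢
        refine ⟨by omega, ?_⟩
        rw [add_comm, Function.iterate_add_apply]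
        exact hj.2
      · intro j _ k _ h
        omega
      · intro j hj
        simp only [Finset.mem_filter, Finset.mem_Ico] at hj
        refine ⟨j - i, ?_, by omega⟩
        simp only [Finset.mem_filter, Finset.mem_Ico]
        refine ⟨by omega, ?_⟩
        rw [← Function.iterate_add_apply, Nat.sub_add_cancel hj.1.1]
        exact hj.2
  by_contra! h
  obtain ⟨L, hL⟩ := exists_nat_gt (T * μ.real G / (c * μ.real E - μ.real G))
  rw [div_lt_iff₀ (by linarith)] at hL
  have := key L
  push_cast at this
  nlinarith

open Classical in
/-- The maximal ergodic inequality for the visits to a set. -/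
lemma measure_exists_card_visits_le {α : Type*} [MeasurableSpace α] {μ : Measure α}
    [IsProbabilityMeasure μ] {f : α → α} (hf : MeasurePreserving f μ μ) {G : Set α}
    (hG : MeasurableSet G) {c : ℝ} (hc : 0 < c) :
    μ {x | ∃ n : ℕ, c * n < ((Finset.Ico 0 n).filter fun j => f^[j] x ∈ G).card} ≤
      ENNReal.ofReal (μ.real G / c) := by
  have e : {x | ∃ n : ℕ, c * n < ((Finset.Ico 0 n).filter fun j => f^[j] x ∈ G).card} =
      ⋃ T, denseVisits f G c T := by
    ext x
    simp only [Set.mem_ofPred_eq, Set.mem_iUnion, denseVisits]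
    constructor
    · rintro ⟨n, hn⟩
      refine ⟨n, n, ?_, le_rfl, hn⟩
      by_contra h
      obtain rfl : n = 0 := by omega
      simp at hn
    · rintro ⟨T, n, _, _, hn⟩
      exact ⟨n, hn⟩
  have hmono : Monotone (denseVisits f G c) := by
    rintro S T hST x ⟨n, h1, h2, h3⟩
    exact ⟨n, h1, h2.trans hST, h3⟩
  rw [e, hmono.measure_iUnion]
  refine iSup_le fun T => ?_
  rw [← ofReal_measureReal]
  refine ENNReal.ofReal_le_ofReal ?_
  rw [le_div_iff₀ hc, mul_comm]
  exact measureReal_denseVisits_le hf hG hc.le T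

/-! ### Averages along residue classes -/

/-- If the averages of a bounded sequence along every residue class modulo `M` converge to `c`,
so do the averages of the sequence. -/
lemma tendsto_average_of_residues {u : ℕ → ℝ} (hu0 : ∀ s, 0 ≤ u s) (hu1 : ∀ s, u s ≤ 1)
    {M : ℕ} (hM : 0 < M) {c : ℝ}
    (h : ∀ r < M, Tendsto (fun m : ℕ => (∑ k ∈ Finset.range m, u (r + M * k)) / (m : ℝ))
      atTop (𝓝 c)) :
    Tendsto (fun n : ℕ => (∑ s ∈ Finset.range n, u s) / (n : ℝ)) atTop (𝓝 c) := by
  have hblock : ∀ m, ∑ s ∈ Finset.range (M * m), u s =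
      ∑ r ∈ Finset.range M, ∑ k ∈ Finset.range m, u (r + M * k) := by
    intro m
    induction m with
    | zero => simp
    | succ m ih =>
      rw [Nat.mul_succ, Finset.sum_range_add, ih, ← Finset.sum_add_distrib]
      refine Finset.sum_congr rfl fun r _ => ?_
      rw [Finset.sum_range_succ, add_comm r]
  have h1 : Tendsto (fun m : ℕ => (∑ s ∈ Finset.range (M * m), u s) / (m : ℝ)) atTop
      (𝓝 (M * c)) := by
    have := tendsto_finsetSum (Finset.range M) fun r hr => h r (Finset.mem_range.1 hr)
    simp only [Finset.sum_const, Finset.card_range, nsmul_eq_mul] at this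
    refine this.congr fun m => ?_
    rw [hblock, Finset.sum_div]
  have hdiv : Tendsto (fun n : ℕ => n / M) atTop atTop := Nat.tendsto_div_const_atTop hM.ne'
  have h2 : Tendsto (fun n : ℕ => ((n / M : ℕ) : ℝ) / (n : ℝ)) atTop (𝓝 (1 / M)) := by
    have := (tendsto_nat_floor_mul_div_atTop (R := ℝ) (a := 1 / M) (by positivity)).comp
      (tendsto_natCast_atTop_atTop (R := ℝ))
    refine this.congr fun n => ?_
    simp only [Function.comp]
    rw [one_div_mul_eq_div, Nat.floor_div_eq_div]
  have h3 : Tendsto (fun n : ℕ => (∑ s ∈ Finset.range (M * (n / M)), u s) / (n : ℝ)) atTop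
      (𝓝 c) := by
    have := (h1.comp hdiv).mul h2
    have hMr : (M : ℝ) ≠ 0 := by positivity
    rw [show (M : ℝ) * c * (1 / M) = c by field_simp] at this
    refine this.congr' ?_
    filter_upwards [eventually_ge_atTop M] with n hn
    have : ((n / M : ℕ) : ℝ) ≠ 0 := by
      have := Nat.div_pos hn hM
      positivity
    simp only [Function.comp]
    field_simp
  have h4 : Tendsto (fun n : ℕ => (∑ s ∈ Finset.range (M * (n / M)), u s) / (n : ℝ) + M / (n : ℝ))
      atTop (𝓝 c) := by
    simpa using h3.add (tendsto_const_div_atTop_nhds_zero_nat (M : ℝ))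
  -- The incomplete last block has fewer than `M` terms, each in `[0, 1]`.
  refine tendsto_of_tendsto_of_tendsto_of_le_of_le h3 h4 (fun n => ?_) fun n => ?_
  · refine div_le_div_of_nonneg_right ?_ (Nat.cast_nonneg n)
    exact Finset.sum_le_sum_of_subset_of_nonneg
      (Finset.range_subset_range.2 (Nat.mul_div_le n M)) fun s _ _ => hu0 s
  · simp only
    rw [← add_div]
    refine div_le_div_of_nonneg_right ?_ (Nat.cast_nonneg n)
    have e : n = M * (n / M) + n % M := (Nat.div_add_mod n M).symm
    conv_lhs => rw [e, Finset.sum_range_add]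
    refine add_le_add le_rfl ?_
    calc ∑ x ∈ Finset.range (n % M), u (M * (n / M) + x) ≤ ∑ x ∈ Finset.range (n % M), (1 : ℝ) :=
          Finset.sum_le_sum fun x _ => hu1 _
      _ ≤ M := by
          simp only [Finset.sum_const, Finset.card_range, nsmul_eq_mul, mul_one]
          exact_mod_cast (Nat.mod_lt n hM).le

/-! ### Deterministic comparison of the boundary with windows -/

variable {d : ℕ}

/-- The left shift on sequences of increments. -/
def shift (x : ℕ → Fin d → ℤ) : ℕ → Fin d → ℤ := fun j => x (j + 1)

lemma shift_iterate (s : ℕ) (x : ℕ → Fin d → ℤ) (j : ℕ) : shift^[s] x j = x (j + s) := by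
  induction s generalizing x with
  | zero => rfl
  | succ s ih => rw [Function.iterate_succ_apply, ih, shift, add_assoc]

lemma walk_add (a : Fin d → ℤ) (x : ℕ → Fin d → ℤ) (s m : ℕ) :
    walk a x (s + m) = walk a x s + walk 0 (shift^[s] x) m := by
  simp only [walk, Finset.sum_range_add, shift_iterate, zero_add, add_assoc, Nat.add_comm _ s]

lemma mem_neighbors_iff (a z : Fin d → ℤ) : z ∈ neighbors a ↔ z - a ∈ neighbors 0 := by
  simp [neighbors]

lemma neg_mem_neighbors_zero (z : Fin d → ℤ) : -z ∈ neighbors 0 ↔ z ∈ neighbors 0 := by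
  simp [neighbors]

lemma neighbors_zero_finite : (neighbors (0 : Fin d → ℤ)).Finite := by
  refine (Set.finite_Icc (-1 : Fin d → ℤ) 1).subset fun z hz => ?_
  have h : ∀ i, |z i| ≤ 1 := fun i => by
    have hz' : ∑ i, |z i| = 1 := by simpa [neighbors] using hz
    rw [← hz']
    exact Finset.single_le_sum (f := fun i => |z i|) (fun i _ => abs_nonneg _) (Finset.mem_univ i)
  exact ⟨fun i => (abs_le.1 (h i)).1, fun i => (abs_le.1 (h i)).2⟩

/-- The increments for which the position at time `K` is not revisited in the time interval
`(K, 2K]` and has a neighbour that is not visited in `[0, 2K]`. -/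
def windowEvent (d K : ℕ) : Set (ℕ → Fin d → ℤ) :=
  {x | ¬ neighbors (walk 0 x K) ⊆ walk 0 x '' {m | m ≤ 2 * K} ∧
    ∀ m, K < m → m ≤ 2 * K → walk 0 x m ≠ walk 0 x K}

/-- The increments for which the walk from the origin is at the origin or at one of its neighbours
at some time after `K`. -/
def lateVisit (d K : ℕ) : Set (ℕ → Fin d → ℤ) :=
  {x | ∃ m, K < m ∧ walk 0 x m ∈ insert 0 (neighbors 0)}

lemma shift_mem_windowEvent_iff (a : Fin d → ℤ) (x : ℕ → Fin d → ℤ) (s K : ℕ) :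
    shift^[s] x ∈ windowEvent d K ↔
      (∃ z ∈ neighbors (walk a x (s + K)), ∀ m, s ≤ m → m ≤ s + 2 * K → walk a x m ≠ z) ∧
      ∀ m, s + K < m → m ≤ s + 2 * K → walk a x m ≠ walk a x (s + K) := by
  simp only [windowEvent, Set.mem_ofPred_eq, Set.not_subset]
  refine and_congr ⟨?_, ?_⟩ ⟨?_, ?_⟩
  · rintro ⟨z, hz, h⟩
    refine ⟨walk a x s + z, ?_, ?_⟩
    · rw [mem_neighbors_iff] at hz ⊢
      rwa [walk_add, add_sub_add_left_eq_sub]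
    · intro m h1 h2 e
      obtain ⟨k, rfl⟩ := Nat.exists_eq_add_of_le h1
      rw [walk_add, add_right_inj] at e
      exact h ⟨k, by simp only [Set.mem_ofPred_eq]; omega, e⟩
  · rintro ⟨z, hz, h⟩
    refine ⟨z - walk a x s, ?_, ?_⟩
    · rw [mem_neighbors_iff] at hz ⊢
      rwa [walk_add, ← sub_sub] at hz
    · rintro ⟨k, hk, e⟩
      simp only [Set.mem_ofPred_eq] at hk
      refine h (s + k) (by omega) (by omega) ?_
      rw [walk_add, e, add_sub_cancel]
  · intro h m h1 h2 e
    obtain ⟨k, rfl⟩ := Nat.exists_eq_add_of_le (by omega : s ≤ m)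
    rw [walk_add, walk_add, add_right_inj] at e
    exact h k (by omega) (by omega) e
  · intro h m h1 h2 e
    exact h (s + m) (by omega) (by omega) (by rw [walk_add, walk_add, e])

lemma shift_mem_lateVisit (a : Fin d → ℤ) (x : ℕ → Fin d → ℤ) {s m K : ℕ} (h : s + K < m)
    (hm : walk a x m - walk a x s ∈ insert 0 (neighbors 0)) : shift^[s] x ∈ lateVisit d K := by
  obtain ⟨k, rfl⟩ := Nat.exists_eq_add_of_le (by omega : s ≤ m)
  rw [walk_add, add_sub_cancel_left] at hm
  exact ⟨k, by omega, hm⟩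

lemma exists_last_visit {S : ℕ → Fin d → ℤ} {i n : ℕ} (hi : i ≤ n) :
    ∃ j ≤ n, S j = S i ∧ ∀ m, j < m → m ≤ n → S m ≠ S j := by
  classical
  have hP : ∃ j, j ≤ n ∧ S j = S i := ⟨i, hi, rfl⟩
  set P : ℕ → Prop := fun j => j ≤ n ∧ S j = S i
  have hj : P (Nat.findGreatest P n) := Nat.findGreatest_spec (P := P) hi ⟨hi, rfl⟩
  refine ⟨_, hj.1, hj.2, fun m h1 h2 e => ?_⟩
  exact Nat.findGreatest_is_greatest h1 h2 ⟨h2, e.trans hj.2⟩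

lemma innerBoundary_finite (S : ℕ → Fin d → ℤ) (n : ℕ) : (innerBoundary S n).Finite := by
  refine ((Set.finite_le_nat n).image S).subset ?_
  rintro z ⟨i, hi, rfl, _⟩
  exact ⟨i, hi, rfl⟩

-- Charge each boundary point to its last visit time `j`. If `K ≤ j ≤ n - K`, the window centred at
-- `j` lies inside `[0, n]`, where a neighbour is missed and no return occurs. The other `j` number
-- at most `2K`.
open Classical in
lemma boundaryCount_le (a : Fin d → ℤ) (x : ℕ → Fin d → ℤ) {K : ℕ} (hK : 0 < K) (n : ℕ) :
    boundaryCount (walk a x) n ≤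
      2 * K + ((Finset.range n).filter fun s => shift^[s] x ∈ windowEvent d K).card := by
  set W := (Finset.range n).filter fun s => shift^[s] x ∈ windowEvent d K with hW
  set I : Finset ℕ := (Finset.range K ∪ Finset.Ioc (n - K) n) ∪ W.image (· + K) with hI
  have hsub : innerBoundary (walk a x) n ⊆ ↑(I.image (walk a x)) := by
    rintro z ⟨i, hi, rfl, hnb⟩
    obtain ⟨j, hj, e, hlast⟩ := exists_last_visit (S := walk a x) hi
    rw [← e] at hnb ⊢
    refine Finset.mem_coe.2 (Finset.mem_image_of_mem _ ?_)
    by_cases h1 : j < K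
    · simp [hI, h1]
    by_cases h2 : n - K < j
    · simp [hI, h2, hj]
    obtain ⟨s, rfl⟩ := Nat.exists_eq_add_of_le' (by omega : K ≤ j)
    refine Finset.mem_union_right _ (Finset.mem_image_of_mem _ ?_)
    rw [hW, Finset.mem_filter, Finset.mem_range, shift_mem_windowEvent_iff a]
    refine ⟨by omega, ?_, fun m h3 h4 => hlast m h3 (by omega)⟩
    obtain ⟨z, hz, hz'⟩ := Set.not_subset.1 hnb
    exact ⟨z, hz, fun m _ h4 e' => hz' ⟨m, by simp only [Set.mem_ofPred_eq]; omega, e'⟩⟩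
  calc boundaryCount (walk a x) n ≤ (I.image (walk a x)).card := by
        rw [boundaryCount, ← Set.ncard_coe_finset]
        exact Set.ncard_le_ncard hsub (Finset.finite_toSet _)
    _ ≤ I.card := Finset.card_image_le
    _ ≤ (K + K) + W.card := by
        refine (Finset.card_union_le _ _).trans
          (add_le_add ((Finset.card_union_le _ _).trans (add_le_add ?_ ?_)) Finset.card_image_le)
        · simp
        · simp only [Nat.card_Ioc]; omega
    _ = _ := by omega

-- Apart from `2K` windows near the end, a window whose centre is not a last-visited boundary point
-- is spoilt from outside. If the walk hits the centre or a neighbour after the window, the centre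
-- time is itself a late-visit time (`B`). Otherwise the missed neighbour was hit at some `j` before
-- the window; seen from `j`, the visit to the centre is late, so `j` is a late-visit time (`D`).
open Classical in
lemma card_windowEvent_le (a : Fin d → ℤ) (x : ℕ → Fin d → ℤ) (K n : ℕ) :
    ((Finset.range n).filter fun s => shift^[s] x ∈ windowEvent d K).card ≤
      boundaryCount (walk a x) n + 2 * K +
      ((neighbors (0 : Fin d → ℤ)).ncard + 1) *
        ((Finset.range (n + 1)).filter fun s => shift^[s] x ∈ lateVisit d K).card := by
  set W := (Finset.range n).filter fun s => shift^[s] x ∈ windowEvent d K with hW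
  set G := (Finset.range (n + 1)).filter fun s => shift^[s] x ∈ lateVisit d K with hG
  set S := walk a x with hS
  set N := (neighbors_zero_finite (d := d)).toFinset with hN
  set A := W.filter fun s => s + K ≤ n ∧ S (s + K) ∈ innerBoundary S n ∧
    ∀ m, s + K < m → m ≤ n → S m ≠ S (s + K) with hA
  set B := W.filter fun s => s + K ∈ G with hB
  set D := W.filter fun s => s + K ≤ n ∧ (∀ m, s + K < m → m ≤ n → S m ≠ S (s + K)) ∧
    ∃ e ∈ N, ∃ j ∈ G, S j = S (s + K) + e with hD
  have hsub : W ⊆ (A ∪ Finset.Ico (n - 2 * K) n) ∪ (B ∪ D) := by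
    intro s hs
    simp only [Finset.mem_union]
    have hs' := hs
    rw [hW, Finset.mem_filter, Finset.mem_range, shift_mem_windowEvent_iff a] at hs
    obtain ⟨hsn, ⟨z, hz, hzw⟩, hret⟩ := hs
    by_cases h1 : n - 2 * K ≤ s
    · exact Or.inl (Or.inr (Finset.mem_Ico.2 ⟨h1, hsn⟩))
    by_cases hgood : s + K ∈ G
    · exact Or.inr (Or.inl (Finset.mem_filter.2 ⟨hs', hgood⟩))
    have hlate : ∀ m, s + 2 * K < m → S m - S (s + K) ∉ insert 0 (neighbors 0) := by
      intro m hm hmem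
      refine hgood (Finset.mem_filter.2 ⟨Finset.mem_range.2 (by omega), ?_⟩)
      exact shift_mem_lateVisit a x (by omega) hmem
    have hlast : ∀ m, s + K < m → m ≤ n → S m ≠ S (s + K) := by
      intro m h2 h3 e
      by_cases h4 : m ≤ s + 2 * K
      · exact hret m h2 h4 e
      · exact hlate m (by omega) (by rw [e, sub_self]; exact Set.mem_insert _ _)
    by_cases hin : neighbors (S (s + K)) ⊆ S '' {m | m ≤ n}
    · obtain ⟨j, hj, e⟩ := hin hz
      simp only [Set.mem_ofPred_eq] at hj
      have hz0 := (mem_neighbors_iff _ _).1 hz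
      refine Or.inr (Or.inr (Finset.mem_filter.2
        ⟨hs', by omega, hlast, z - S (s + K), ?_, j, ?_, ?_⟩))
      · exact (Set.Finite.mem_toFinset _).2 hz0
      · refine Finset.mem_filter.2 ⟨Finset.mem_range.2 (by omega), ?_⟩
        have hjs : j < s := by
          by_contra h
          by_cases h5 : j ≤ s + 2 * K
          · exact hzw j (by omega) h5 e
          · exact hlate j (by omega) (by rw [e]; exact Set.mem_insert_of_mem _ hz0)
        refine shift_mem_lateVisit a x (m := s + K) (by omega) (Set.mem_insert_of_mem _ ?_)
        rw [← neg_mem_neighbors_zero, neg_sub]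
        change S j - S (s + K) ∈ _
        rwa [e]
      · rw [e]; abel
    · exact Or.inl (Or.inl (Finset.mem_filter.2
        ⟨hs', by omega, ⟨s + K, by omega, rfl, hin⟩, hlast⟩))
  have hAc : A.card ≤ boundaryCount S n := by
    rw [boundaryCount, Set.ncard_eq_toFinset_card _ (innerBoundary_finite S n)]
    refine Finset.card_le_card_of_injOn (fun s => S (s + K)) ?_ ?_
    · intro s hs
      simpa using (Finset.mem_filter.1 (Finset.mem_coe.1 hs)).2.2.1
    · intro s hs t ht e
      obtain ⟨-, h1, -, h2⟩ := Finset.mem_filter.1 (Finset.mem_coe.1 hs)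
      obtain ⟨-, h3, -, h4⟩ := Finset.mem_filter.1 (Finset.mem_coe.1 ht)
      rcases lt_trichotomy s t with h | h | h
      · exact absurd e.symm (h2 _ (by omega) h3)
      · exact h
      · exact absurd e (h4 _ (by omega) h1)
  have hBc : B.card ≤ G.card := by
    refine Finset.card_le_card_of_injOn (· + K) ?_ ?_
    · intro s hs
      exact (Finset.mem_filter.1 (Finset.mem_coe.1 hs)).2
    · intro s _ t _ e
      simpa using e
  have hDc : D.card ≤ (neighbors (0 : Fin d → ℤ)).ncard * G.card := by
    rw [Set.ncard_eq_toFinset_card _ neighbors_zero_finite, ← Finset.card_product]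
    have hch : ∀ s, ∃ p : (Fin d → ℤ) × ℕ, s ∈ D →
        p.1 ∈ N ∧ p.2 ∈ G ∧ S p.2 = S (s + K) + p.1 := by
      intro s
      by_cases hs : s ∈ D
      · obtain ⟨-, -, -, e, he, j, hj, h⟩ := Finset.mem_filter.1 hs
        exact ⟨(e, j), fun _ => ⟨he, hj, h⟩⟩
      · exact ⟨(0, 0), fun h => absurd h hs⟩
    choose p hp using hch
    -- The time `j` and the direction of the neighbour determine the centre point, and being the
    -- last visit to that point determines `s`.
    refine Finset.card_le_card_of_injOn p ?_ ?_
    · intro s hs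
      exact Finset.mem_coe.2 (Finset.mem_product.2 ⟨(hp s hs).1, (hp s hs).2.1⟩)
    · intro s hs t ht e
      have e' : S (s + K) = S (t + K) := by
        have h1 := (hp s hs).2.2
        have h2 := (hp t ht).2.2
        rw [e, h2] at h1
        exact (add_right_cancel h1).symm
      obtain ⟨-, h1, h2, -⟩ := Finset.mem_filter.1 (Finset.mem_coe.1 hs)
      obtain ⟨-, h3, h4, -⟩ := Finset.mem_filter.1 (Finset.mem_coe.1 ht)
      rcases lt_trichotomy s t with h | h | h
      · exact absurd e'.symm (h2 _ (by omega) h3)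
      · exact h
      · exact absurd e' (h4 _ (by omega) h1)
  calc W.card ≤ (A.card + (Finset.Ico (n - 2 * K) n).card) + (B.card + D.card) := by
        refine (Finset.card_le_card hsub).trans ((Finset.card_union_le _ _).trans ?_)
        exact add_le_add (Finset.card_union_le _ _) (Finset.card_union_le _ _)
    _ ≤ (boundaryCount S n + 2 * K) +
        (G.card + (neighbors (0 : Fin d → ℤ)).ncard * G.card) := by
        refine add_le_add (add_le_add hAc ?_) (add_le_add hBc hDc)
        simp only [Nat.card_Ico]; omega
    _ = _ := by ring

/-! ### The i.i.d. law and the law of large numbers for windows -/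

/-- The law of a sequence of independent increments with law `ν`. -/
noncomputable def iidLaw (ν : Measure (Fin d → ℤ)) : Measure (ℕ → Fin d → ℤ) :=
  Measure.infinitePi fun _ : ℕ => ν

instance (ν : Measure (Fin d → ℤ)) [IsProbabilityMeasure ν] : IsProbabilityMeasure (iidLaw ν) := by
  unfold iidLaw; infer_instance

lemma comap_reindex_le {κ : Type*} (ρ : κ → ℕ) :
    MeasurableSpace.comap (fun (x : ℕ → Fin d → ℤ) i => x (ρ i)) MeasurableSpace.pi ≤
      ⨆ i ∈ Set.range ρ, MeasurableSpace.comap (fun x : ℕ → Fin d → ℤ => x i) inferInstance := by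
  rw [← measurable_iff_comap_le]
  refine @measurable_pi_lambda _ _ _ (_) _ _ fun i => ?_
  rw [measurable_iff_comap_le]
  exact le_iSup₂_of_le (ρ i) ⟨i, rfl⟩ le_rfl

section

variable (ν : Measure (Fin d → ℤ)) [IsProbabilityMeasure ν]

lemma map_reindex {τ : ℕ → ℕ} (hτ : Function.Injective τ) :
    (iidLaw ν).map (fun x j => x (τ j)) = iidLaw ν :=
  Measure.map_infinitePi_infinitePi_of_inj hτ

lemma measurePreserving_shift : MeasurePreserving shift (iidLaw ν) (iidLaw ν) :=
  ⟨by unfold shift; fun_prop, map_reindex ν (τ := fun j => j + 1) (add_left_injective 1)⟩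

lemma indepFun_reindex {ι κ : Type*} {σ : ι → ℕ} {τ : κ → ℕ} (h : ∀ i j, σ i ≠ τ j) :
    IndepFun (fun (x : ℕ → Fin d → ℤ) i => x (σ i)) (fun x j => x (τ j)) (iidLaw ν) := by
  have hi : iIndepFun (fun (i : ℕ) (x : ℕ → Fin d → ℤ) => x i) (iidLaw ν) :=
    iIndepFun_infinitePi (X := fun _ x => x) fun _ => measurable_id
  have hle : ∀ i : ℕ, MeasurableSpace.comap (fun x : ℕ → Fin d → ℤ => x i) inferInstance ≤
      MeasurableSpace.pi := fun i => (measurable_pi_apply i).comap_le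
  have hd : Disjoint (Set.range σ) (Set.range τ) := by
    rw [Set.disjoint_left]
    rintro _ ⟨i, rfl⟩ ⟨j, e⟩
    exact h i j e.symm
  have key := indep_iSup_of_disjoint hle hi hd
  rw [IndepFun_iff_Indep]
  exact indep_of_indep_of_le_left (indep_of_indep_of_le_right key (comap_reindex_le τ))
    (comap_reindex_le σ)

open Classical in
/-- The law of large numbers for the occurrences along the orbit of the shift of an event that
depends on finitely many increments. -/
lemma tendsto_card_shift_mem {W : Set (ℕ → Fin d → ℤ)} (hW : MeasurableSet W) {M : ℕ}
    (hM : 0 < M) (hdep : ∀ x y : ℕ → Fin d → ℤ, (∀ j < M, x j = y j) → x ∈ W → y ∈ W) :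
    ∀ᵐ x ∂(iidLaw ν), Tendsto
      (fun n : ℕ => (((Finset.range n).filter fun s => shift^[s] x ∈ W).card : ℝ) / n)
      atTop (𝓝 ((iidLaw ν).real W)) := by
  set μ := iidLaw ν
  set φ : (ℕ → Fin d → ℤ) → ℝ := W.indicator fun _ => 1 with hφ
  have hφm : Measurable φ := measurable_const.indicator hW
  -- Padding by `0` is harmless, since `W` ignores coordinates from `M` on; it exhibits the
  -- indicator as a function of `M` increments.
  set ext : (Fin M → Fin d → ℤ) → ℕ → Fin d → ℤ := fun z j => if h : j < M then z ⟨j, h⟩ else 0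
    with hext
  have hextm : Measurable ext := by
    refine measurable_pi_lambda _ fun j => ?_
    by_cases h : j < M
    · simp only [hext, h, dite_true]; exact measurable_pi_apply _
    · simp only [hext, h, dite_false]; exact measurable_const
  have hfact : ∀ s x, φ (shift^[s] x) = φ (ext fun j : Fin M => x (j + s)) := by
    intro s x
    have hag : ∀ j < M, shift^[s] x j = ext (fun j : Fin M => x (j + s)) j := by
      intro j hj
      simp [hext, hj, shift_iterate]
    have : shift^[s] x ∈ W ↔ ext (fun j : Fin M => x (j + s)) ∈ W :=
      ⟨hdep _ _ hag, hdep _ _ fun j hj => (hag j hj).symm⟩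
    simp only [hφ, Set.indicator_apply, this]
  have hiter : ∀ s, MeasurePreserving shift^[s] μ μ := (measurePreserving_shift ν).iterate
  have hint : ∀ s, Integrable (fun x => φ (shift^[s] x)) μ := fun s =>
    (hiter s).integrable_comp_of_integrable ((integrable_const (1 : ℝ)).indicator hW)
  have hid : ∀ s, IdentDistrib (fun x => φ (shift^[s] x)) φ μ μ := fun s =>
    ⟨(hφm.comp (hiter s).measurable).aemeasurable, hφm.aemeasurable, by
      rw [← (hiter s).map_eq, Measure.map_map hφm (hiter s).measurable, (hiter s).map_eq]; rfl⟩
  -- Shifts that differ by nonzero multiples of `M` use disjoint sets of increments.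
  have hres : ∀ r, ∀ᵐ x ∂μ, Tendsto (fun m : ℕ =>
      (∑ k ∈ Finset.range m, φ (shift^[r + M * k] x)) / (m : ℝ)) atTop (𝓝 (μ.real W)) := by
    intro r
    have := strong_law_ae_real (μ := μ) (fun k x => φ (shift^[r + M * k] x)) (hint _) ?_
      fun k => (hid _).trans (hid _).symm
    · have he : ∫ x, φ (shift^[r + M * 0] x) ∂μ = μ.real W := by
        rw [(hid _).integral_eq, hφ, integral_indicator_const _ hW, smul_eq_mul, mul_one]
      rwa [he] at this
    · intro k l hkl
      simp only [Function.onFun, hfact]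
      refine (indepFun_reindex ν (σ := fun j : Fin M => j + (r + M * k))
        (τ := fun j : Fin M => j + (r + M * l)) ?_).comp (hφm.comp hextm) (hφm.comp hextm)
      intro i j e
      apply hkl
      have e' : (i : ℕ) + M * k = j + M * l := by omega
      have h1 : ((i : ℕ) + M * k) / M = k := by
        rw [Nat.add_mul_div_left _ _ hM, Nat.div_eq_of_lt i.2, zero_add]
      have h2 : ((j : ℕ) + M * l) / M = l := by
        rw [Nat.add_mul_div_left _ _ hM, Nat.div_eq_of_lt j.2, zero_add]
      rw [← h1, e', h2]
  filter_upwards [ae_all_iff.2 hres] with x hx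
  have := tendsto_average_of_residues (u := fun s => φ (shift^[s] x)) (fun s => ?_) (fun s => ?_)
    hM fun r _ => hx r
  · refine this.congr fun n => ?_
    congr 1
    simp [hφ, Set.indicator_apply]
  · exact Set.indicator_nonneg (fun _ _ => zero_le_one) _
  · exact Set.indicator_le_self' (fun _ _ => zero_le_one) _

end

/-! ### Measurability and locality of the events -/

lemma measurable_walk (a : Fin d → ℤ) (m : ℕ) : Measurable fun x => walk a x m := by
  unfold walk
  fun_prop

lemma measurableSet_windowEvent (K : ℕ) : MeasurableSet (windowEvent d K) := by
  have : windowEvent d K =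
      (⋃ z : Fin d → ℤ, {x | walk 0 x K ∈ {a | z ∈ neighbors a}} ∩
        ⋂ m, ⋂ (_ : m ≤ 2 * K), {x | walk 0 x m ∈ ({z}ᶜ : Set _)}) ∩
      ⋂ m, ⋂ (_ : K < m), ⋂ (_ : m ≤ 2 * K),
        {x | walk 0 x m - walk 0 x K ∈ ({0}ᶜ : Set (Fin d → ℤ))} := by
    ext x
    simp [windowEvent, Set.not_subset, sub_eq_zero]
  rw [this]
  refine MeasurableSet.inter (MeasurableSet.iUnion fun z => MeasurableSet.inter ?_ ?_) ?_
  · exact measurable_walk 0 K (Set.to_countable _).measurableSet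
  · exact MeasurableSet.iInter fun m => MeasurableSet.iInter fun _ =>
      measurable_walk 0 m (Set.to_countable _).measurableSet
  · exact MeasurableSet.iInter fun m => MeasurableSet.iInter fun _ => MeasurableSet.iInter fun _ =>
      ((measurable_walk 0 m).sub (measurable_walk 0 K)) (Set.to_countable _).measurableSet

lemma measurableSet_lateVisit (K : ℕ) : MeasurableSet (lateVisit d K) := by
  have : lateVisit d K = ⋃ m, ⋃ (_ : K < m), {x | walk 0 x m ∈ insert 0 (neighbors 0)} := by
    ext x
    simp [lateVisit]
  rw [this]
  exact MeasurableSet.iUnion fun m => MeasurableSet.iUnion fun _ =>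
    measurable_walk 0 m (Set.to_countable _).measurableSet

lemma windowEvent_congr {K : ℕ} {x y : ℕ → Fin d → ℤ} (h : ∀ j < 2 * K, x j = y j)
    (hx : x ∈ windowEvent d K) : y ∈ windowEvent d K := by
  have hw : ∀ m ≤ 2 * K, walk 0 x m = walk 0 y m := fun m hm => by
    unfold walk
    congr 1
    exact Finset.sum_congr rfl fun j hj => h j (by have := Finset.mem_range.1 hj; omega)
  refine ⟨fun hs => hx.1 ?_, fun m h1 h2 => ?_⟩
  · rw [hw K (by omega)]
    refine hs.trans ?_
    rintro _ ⟨m, hm, rfl⟩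
    exact ⟨m, hm, hw m hm⟩
  · rw [← hw m h2, ← hw K (by omega)]
    exact hx.2 m h1 h2

/-! ### Window probabilities and their limit -/

/-- The pairs of paths for which the conditions in `escapeEvent` hold up to time `K`. -/
def escapeUpTo (d K : ℕ) : Set ((ℕ → Fin d → ℤ) × (ℕ → Fin d → ℤ)) :=
  {p | (∃ z ∈ neighbors 0, ∀ m ≤ K, p.1 m ≠ z ∧ p.2 m ≠ z) ∧ ∀ m, 1 ≤ m → m ≤ K → p.1 m ≠ 0}

lemma measurableSet_escapeUpTo (K : ℕ) : MeasurableSet (escapeUpTo d K) := by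
  have : escapeUpTo d K =
      (⋃ z : Fin d → ℤ, ⋃ (_ : z ∈ neighbors 0), ⋂ m, ⋂ (_ : m ≤ K),
        ({p | p.1 m ∈ ({z}ᶜ : Set _)} ∩ {p | p.2 m ∈ ({z}ᶜ : Set _)})) ∩
      ⋂ m, ⋂ (_ : 1 ≤ m), ⋂ (_ : m ≤ K), {p | p.1 m ∈ ({0}ᶜ : Set (Fin d → ℤ))} := by
    ext p
    simp [escapeUpTo]
  rw [this]
  have h1 : ∀ (m : ℕ) (z : Fin d → ℤ), MeasurableSet
      {p : (ℕ → Fin d → ℤ) × (ℕ → Fin d → ℤ) | p.1 m ∈ ({z}ᶜ : Set _)} := fun m z =>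
    ((measurable_pi_apply m).comp measurable_fst) (Set.to_countable _).measurableSet
  have h2 : ∀ (m : ℕ) (z : Fin d → ℤ), MeasurableSet
      {p : (ℕ → Fin d → ℤ) × (ℕ → Fin d → ℤ) | p.2 m ∈ ({z}ᶜ : Set _)} := fun m z =>
    ((measurable_pi_apply m).comp measurable_snd) (Set.to_countable _).measurableSet
  refine MeasurableSet.inter (MeasurableSet.iUnion fun z => MeasurableSet.iUnion fun _ =>
    MeasurableSet.iInter fun m => MeasurableSet.iInter fun _ => (h1 m z).inter (h2 m z)) ?_
  exact MeasurableSet.iInter fun m => MeasurableSet.iInter fun _ => MeasurableSet.iInter fun _ =>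
    h1 m 0

lemma antitone_escapeUpTo : Antitone (escapeUpTo d) := by
  rintro K L hKL p ⟨⟨z, hz, h⟩, h'⟩
  exact ⟨⟨z, hz, fun m hm => h m (hm.trans hKL)⟩, fun m h1 h2 => h' m h1 (h2.trans hKL)⟩

/-- The missed neighbour may vary with `K`, but there are finitely many: if all were hit, they would
all be hit by a common time. -/
lemma iInter_escapeUpTo : ⋂ K, escapeUpTo d K = escapeEvent d := by
  ext p
  simp only [Set.mem_iInter]
  constructor
  · intro h
    refine ⟨fun hsub => ?_, fun m hm => (h m).2 m hm le_rfl⟩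
    have hex : ∀ z : Fin d → ℤ, ∃ m, z ∈ neighbors 0 → p.1 m = z ∨ p.2 m = z := by
      intro z
      by_cases hz : z ∈ neighbors 0
      · rcases hsub hz with ⟨m, hm⟩ | ⟨m, hm⟩
        exacts [⟨m, fun _ => Or.inl hm⟩, ⟨m, fun _ => Or.inr hm⟩]
      · exact ⟨0, fun h => absurd h hz⟩
    choose m hm using hex
    obtain ⟨z, hz, hz'⟩ := (h (neighbors_zero_finite.toFinset.sup m)).1
    have := hz' (m z) (Finset.le_sup (f := m) ((Set.Finite.mem_toFinset _).2 hz))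
    exact (hm z hz).elim this.1 this.2
  · rintro ⟨h1, h2⟩ K
    obtain ⟨z, hz, hz'⟩ := Set.not_subset.1 h1
    simp only [Set.mem_union, Set.mem_range, not_or, not_exists] at hz'
    exact ⟨⟨z, hz, fun m _ => ⟨hz'.1 m, hz'.2 m⟩⟩, fun m hm _ => h2 m hm⟩

section

variable (ν : Measure (Fin d → ℤ)) [IsProbabilityMeasure ν]

/-- The law of a walk from the origin and of the negative of an independent copy of it. -/
noncomputable def pairLaw : Measure ((ℕ → Fin d → ℤ) × (ℕ → Fin d → ℤ)) :=
  ((iidLaw ν).map (walk 0)).prod ((iidLaw ν).map fun x => -walk 0 x)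

lemma measurable_walk_path : Measurable (walk (0 : Fin d → ℤ)) :=
  measurable_pi_lambda _ fun m => measurable_walk 0 m

instance : IsProbabilityMeasure (pairLaw ν) := by
  have h1 := Measure.isProbabilityMeasure_map (μ := iidLaw ν)
    (measurable_walk_path (d := d)).aemeasurable
  have h2 := Measure.isProbabilityMeasure_map (μ := iidLaw ν)
    (measurable_walk_path (d := d)).neg.aemeasurable
  unfold pairLaw
  exact inferInstanceAs (IsProbabilityMeasure (Measure.prod _ _))

/-- This realises the independent pair on a single sequence space, where it can be compared with a
window. -/
lemma map_even_odd : (iidLaw ν).map (fun x => (walk 0 fun j => x (2 * j),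
    -walk 0 fun j => x (2 * j + 1))) = pairLaw ν := by
  have hw := measurable_walk_path (d := d)
  have h := (indepFun_reindex ν (σ := fun j : ℕ => 2 * j) (τ := fun j : ℕ => 2 * j + 1)
    (fun i j => by omega)).comp hw hw.neg
  have h0 : Measurable fun (x : ℕ → Fin d → ℤ) (j : ℕ) => x (2 * j) := by fun_prop
  have h1 : Measurable fun (x : ℕ → Fin d → ℤ) (j : ℕ) => x (2 * j + 1) := by fun_prop
  have := (indepFun_iff_map_prod_eq_prod_map_map (hw.comp h0).aemeasurable
    (hw.neg.comp h1).aemeasurable).1 h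
  rw [← Measure.map_map hw h0, ← Measure.map_map hw.neg h1,
    map_reindex ν (fun i j => by simp), map_reindex ν (fun i j => by simp)] at this
  exact this

/-- The injection that lists the first `K` odd numbers in decreasing order and then the even
numbers in increasing order. -/
def unfoldIndex (K j : ℕ) : ℕ := if j < K then 2 * (K - 1 - j) + 1 else 2 * (j - K)

lemma unfoldIndex_injective (K : ℕ) : Function.Injective (unfoldIndex K) := by
  intro i j h
  unfold unfoldIndex at h
  split_ifs at h <;> omega

/-- Relative to the position at time `K`, the future is the walk with even increments, and the past
read backwards is the negated walk with odd increments. -/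
lemma unfold_mem_windowEvent_iff (K : ℕ) (x : ℕ → Fin d → ℤ) :
    (fun j => x (unfoldIndex K j)) ∈ windowEvent d K ↔
      ((walk 0 fun j => x (2 * j)), -walk 0 fun j => x (2 * j + 1)) ∈ escapeUpTo d K := by
  set y := fun j => x (unfoldIndex K j) with hy
  have hfwd : ∀ m, walk 0 y (K + m) = walk 0 y K + walk 0 (fun j => x (2 * j)) m := by
    intro m
    rw [walk_add]
    congr 2
    ext1 j
    simp [shift_iterate, hy, unfoldIndex]
  have hbwd : ∀ m ≤ K, walk 0 y (K - m) = walk 0 y K + -walk 0 (fun j => x (2 * j + 1)) m := by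
    intro m hm
    have h1 : walk 0 y K = walk 0 y (K - m) + walk 0 (shift^[K - m] y) m := by
      rw [← walk_add, Nat.sub_add_cancel hm]
    have h2 : walk 0 (shift^[K - m] y) m = walk 0 (fun j => x (2 * j + 1)) m := by
      unfold walk
      congr 1
      -- The odd increments occur in decreasing order before time `K`; reflection restores their
      -- order.
      rw [← Finset.sum_range_reflect]
      refine Finset.sum_congr rfl fun j hj => ?_
      have hj := Finset.mem_range.1 hj
      rw [shift_iterate, hy]
      simp only [unfoldIndex]
      rw [if_pos (by omega)]
      congr 2
      omega
    rw [h1, h2, add_neg_cancel_right]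
  have := shift_mem_windowEvent_iff 0 y 0 K
  simp only [Function.iterate_zero, id, zero_add] at this
  rw [this]
  refine and_congr ⟨?_, ?_⟩ ⟨?_, ?_⟩
  · rintro ⟨z, hz, h⟩
    refine ⟨_, (mem_neighbors_iff _ _).1 hz, fun m hm => ⟨fun e => ?_, fun e => ?_⟩⟩
    · dsimp only at e
      exact h (K + m) (by omega) (by omega) (by rw [hfwd, e, add_sub_cancel])
    · dsimp only at e
      refine h (K - m) (by omega) (by omega) ?_
      rw [hbwd m hm, ← Pi.neg_apply, e, add_sub_cancel]
  · rintro ⟨z, hz, h⟩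
    refine ⟨walk 0 y K + z, (mem_neighbors_iff _ _).2 (by rwa [add_sub_cancel_left]), ?_⟩
    intro m _ hm e
    rcases le_total K m with hKm | hmK
    · obtain ⟨k, rfl⟩ := Nat.exists_eq_add_of_le hKm
      rw [hfwd, add_right_inj] at e
      exact (h k (by omega)).1 e
    · have e1 := hbwd (K - m) (by omega)
      rw [Nat.sub_sub_self hmK, e, add_right_inj] at e1
      exact (h (K - m) (by omega)).2 e1.symm
  · intro h m h1 h2 e
    dsimp only at e
    exact h (K + m) (by omega) (by omega) (by rw [hfwd, e, add_zero])
  · intro h m h1 h2 e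
    obtain ⟨k, rfl⟩ := Nat.exists_eq_add_of_le h1.le
    rw [hfwd, add_eq_left] at e
    exact h k (by omega) (by omega) e

lemma measureReal_windowEvent (K : ℕ) :
    (iidLaw ν).real (windowEvent d K) = (pairLaw ν).real (escapeUpTo d K) := by
  have hτ : Measurable fun (x : ℕ → Fin d → ℤ) (j : ℕ) => x (unfoldIndex K j) := by fun_prop
  have hw := measurable_walk_path (d := d)
  have h0 : Measurable fun (x : ℕ → Fin d → ℤ) (j : ℕ) => x (2 * j) := by fun_prop
  have h1 : Measurable fun (x : ℕ → Fin d → ℤ) (j : ℕ) => x (2 * j + 1) := by fun_prop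
  have hm : Measurable fun x : ℕ → Fin d → ℤ =>
      (walk 0 fun j => x (2 * j), -walk 0 fun j => x (2 * j + 1)) :=
    (hw.comp h0).prodMk (hw.neg.comp h1)
  rw [measureReal_def, measureReal_def, ← map_even_odd ν,
    Measure.map_apply hm (measurableSet_escapeUpTo K)]
  conv_lhs => rw [← map_reindex ν (unfoldIndex_injective K),
    Measure.map_apply hτ (measurableSet_windowEvent K)]
  congr 2
  ext x
  exact unfold_mem_windowEvent_iff K x

lemma tendsto_measureReal_windowEvent :
    Tendsto (fun K => (iidLaw ν).real (windowEvent d K)) atTop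
      (𝓝 ((pairLaw ν).real (escapeEvent d))) := by
  simp_rw [measureReal_windowEvent, ← iInter_escapeUpTo]
  refine (ENNReal.tendsto_toReal (measure_ne_top (pairLaw ν) _)).comp ?_
  exact tendsto_measure_iInter_atTop (fun K => (measurableSet_escapeUpTo K).nullMeasurableSet)
    antitone_escapeUpTo ⟨0, measure_ne_top _ _⟩

/-! ### Transience and rarity of late visits -/

/-- The increments for which the walk from the origin never returns to the origin. -/
def noReturn (d : ℕ) : Set (ℕ → Fin d → ℤ) := {x | ∀ m, 1 ≤ m → walk 0 x m ≠ 0}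

lemma measurableSet_noReturn : MeasurableSet (noReturn d) := by
  have : noReturn d = ⋂ m, ⋂ (_ : 1 ≤ m), {x | walk 0 x m ∈ ({0}ᶜ : Set (Fin d → ℤ))} := by
    ext x
    simp [noReturn]
  rw [this]
  exact MeasurableSet.iInter fun m => MeasurableSet.iInter fun _ =>
    measurable_walk 0 m (Set.to_countable _).measurableSet

lemma escapeEvent_le_noReturn : pairLaw ν (escapeEvent d) ≤ iidLaw ν (noReturn d) := by
  have hw := measurable_walk_path (d := d)
  have h2 := Measure.isProbabilityMeasure_map (μ := iidLaw ν) hw.neg.aemeasurable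
  have hs : escapeEvent d ⊆ Prod.fst ⁻¹' {S | ∀ m, 1 ≤ m → S m ≠ 0} := fun p hp => hp.2
  have hm : MeasurableSet {S : ℕ → Fin d → ℤ | ∀ m, 1 ≤ m → S m ≠ 0} := by
    have : {S : ℕ → Fin d → ℤ | ∀ m, 1 ≤ m → S m ≠ 0} =
        ⋂ m, ⋂ (_ : 1 ≤ m), {S | S m ∈ ({0}ᶜ : Set (Fin d → ℤ))} := by
      ext S
      simp
    rw [this]
    exact MeasurableSet.iInter fun m => MeasurableSet.iInter fun _ =>
      measurable_pi_apply m (Set.to_countable _).measurableSet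
  refine (measure_mono hs).trans_eq ?_
  unfold pairLaw
  have h3 : IsProbabilityMeasure ((iidLaw ν).map fun x => -walk 0 x) := h2
  rw [← Set.prod_univ, Measure.prod_prod, measure_univ, mul_one, Measure.map_apply hw hm]
  rfl

/-- Last exit decomposition. -/
lemma tsum_measure_walk_eq_mul_le (z : Fin d → ℤ) :
    (∑' m, iidLaw ν {x | walk 0 x m = z}) * iidLaw ν (noReturn d) ≤ 1 := by
  set μ := iidLaw ν
  have hz : ∀ m, MeasurableSet {x : ℕ → Fin d → ℤ | walk 0 x m = z} := fun m =>
    measurable_walk 0 m (Set.to_countable {z}).measurableSet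
  have hsh : ∀ m, MeasurePreserving shift^[m] μ μ := (measurePreserving_shift ν).iterate
  -- The first `m` increments are independent of the rest, so the product is the probability that
  -- `m` is the last visit to `z`. These events are disjoint in `m`.
  have hprod : ∀ m, μ {x | walk 0 x m = z} * μ (noReturn d) =
      μ ({x | walk 0 x m = z} ∩ shift^[m] ⁻¹' noReturn d) := by
    intro m
    have hi := indepFun_reindex ν (σ := fun j : Fin m => (j : ℕ)) (τ := fun j : ℕ => j + m)
      (fun i j => by have := i.2; omega)
    have e1 : {x : ℕ → Fin d → ℤ | walk 0 x m = z} =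
        (fun x (i : Fin m) => x (i : ℕ)) ⁻¹' {y | ∑ i, y i = z} := by
      ext x
      simp [walk, Finset.sum_range]
    have e2 : shift^[m] ⁻¹' noReturn d = (fun x j => x (j + m)) ⁻¹' noReturn d := by
      have : shift^[m] = fun (x : ℕ → Fin d → ℤ) j => x (j + m) := by
        ext1 x
        ext1 j
        exact shift_iterate m x j
      rw [this]
    have hm : MeasurableSet {y : Fin m → Fin d → ℤ | ∑ i, y i = z} :=
      (show Measurable fun y : Fin m → Fin d → ℤ => ∑ i, y i by fun_prop)
        (Set.to_countable {z}).measurableSet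
    have e3 : μ (noReturn d) = μ (shift^[m] ⁻¹' noReturn d) :=
      ((hsh m).measure_preimage measurableSet_noReturn.nullMeasurableSet).symm
    rw [e3, e1, e2]
    exact (hi.measure_inter_preimage_eq_mul _ _ hm measurableSet_noReturn).symm
  rw [← ENNReal.tsum_mul_right]
  simp only [hprod]
  rw [← measure_iUnion]
  · exact prob_le_one
  · have hlt : ∀ m n, m < n → Disjoint ({x | walk 0 x m = z} ∩ shift^[m] ⁻¹' noReturn d)
        ({x | walk 0 x n = z} ∩ shift^[n] ⁻¹' noReturn d) := by
      intro m n hmn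
      rw [Set.disjoint_left]
      rintro x ⟨h1, h2⟩ ⟨h3, -⟩
      obtain ⟨k, rfl⟩ := Nat.exists_eq_add_of_le hmn.le
      simp only [Set.mem_ofPred_eq] at h1 h3
      rw [walk_add, h1, add_eq_left] at h3
      exact h2 k (by omega) h3
    intro m n hmn
    rcases lt_or_gt_of_ne hmn with h | h
    · exact hlt m n h
    · exact (hlt n m h).symm
  · exact fun m => (hz m).inter ((hsh m).measurable measurableSet_noReturn)

/-- The last exit bound makes the visit probabilities to each point summable. By Borel–Cantelli the
finite set formed by the origin and its neighbours is almost surely left for good, so the decreasing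
events have null intersection. -/
lemma tendsto_measureReal_lateVisit (h : iidLaw ν (noReturn d) ≠ 0) :
    Tendsto (fun K => (iidLaw ν).real (lateVisit d K)) atTop (𝓝 0) := by
  set μ := iidLaw ν
  have hfin : ∀ z : Fin d → ℤ, ∀ᵐ x ∂μ, ∀ᶠ m in atTop, walk 0 x m ≠ z := by
    intro z
    have hs : ∑' m, μ {x | walk 0 x m = z} ≠ ⊤ := by
      intro e
      have := tsum_measure_walk_eq_mul_le ν z
      rw [e, ENNReal.top_mul h] at this
      simp at this
    exact ae_eventually_notMem hs
  have hnull : μ (⋂ K, lateVisit d K) = 0 := by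
    have hae : ∀ᵐ x ∂μ, ∀ z : Fin d → ℤ, ∀ᶠ m in atTop, walk 0 x m ≠ z := ae_all_iff.2 hfin
    rw [measure_eq_zero_iff_ae_notMem]
    filter_upwards [hae] with x hx' hx
    have hev : ∀ᶠ m in atTop, ∀ z ∈ insert (0 : Fin d → ℤ) (neighbors 0), walk 0 x m ≠ z :=
      (neighbors_zero_finite.insert 0).eventually_all.2 fun z _ => hx' z
    obtain ⟨K, hK⟩ := eventually_atTop.1 hev
    obtain ⟨m, hm, hm'⟩ := Set.mem_iInter.1 hx K
    exact hK m hm.le _ hm' rfl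
  have hanti : Antitone (lateVisit d) := by
    rintro K L hKL x ⟨m, hm, hm'⟩
    exact ⟨m, hKL.trans_lt hm, hm'⟩
  have := tendsto_measure_iInter_atTop (μ := μ)
    (fun K => (measurableSet_lateVisit (d := d) K).nullMeasurableSet) hanti
    ⟨0, measure_ne_top _ _⟩
  rw [hnull] at this
  exact (ENNReal.tendsto_toReal ENNReal.zero_ne_top).comp this

-- Since `lateVisit` decreases in `K`, a bound at one `K` serves all larger ones. Failure thus has
-- probability at most that given by the maximal inequality at every `K`, which tends to `0`.
open Classical in
lemma ae_exists_card_lateVisit_le (h : iidLaw ν (noReturn d) ≠ 0) {c : ℝ} (hc : 0 < c) :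
    ∀ᵐ x ∂(iidLaw ν), ∃ K₀, ∀ K ≥ K₀, ∀ n : ℕ,
      (((Finset.range n).filter fun s => shift^[s] x ∈ lateVisit d K).card : ℝ) ≤ c * n := by
  have hK : ∀ K, iidLaw ν {x | ¬ ∃ K₀, ∀ K ≥ K₀, ∀ n : ℕ,
      (((Finset.range n).filter fun s => shift^[s] x ∈ lateVisit d K).card : ℝ) ≤ c * n} ≤
      ENNReal.ofReal ((iidLaw ν).real (lateVisit d K) / c) := by
    intro K
    refine (measure_mono fun x hx => ?_).trans (measure_exists_card_visits_le
      (measurePreserving_shift ν) (measurableSet_lateVisit K) hc)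
    simp only [Set.mem_ofPred_eq] at hx ⊢
    by_contra! hcon
    refine hx ⟨K, fun L hL n => le_trans ?_ (hcon n)⟩
    rw [Finset.range_eq_Ico]
    refine Nat.cast_le.2 (Finset.card_le_card (Finset.monotone_filter_right _ fun s _ hs => ?_))
    obtain ⟨m, hm, hm'⟩ := hs
    exact ⟨m, hL.trans_lt hm, hm'⟩
  have hlim := ENNReal.tendsto_ofReal ((tendsto_measureReal_lateVisit ν h).div_const c)
  rw [zero_div, ENNReal.ofReal_zero] at hlim
  exact le_antisymm (ge_of_tendsto' hlim hK) (zero_le)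

/-! ### Almost sure convergence -/

/-- The boundary of the range of the walk with increments of law `ν` grows at the rate
`pairLaw ν (escapeEvent d)`. -/
lemma tendsto_boundaryCount_div (a : Fin d → ℤ) :
    ∀ᵐ x ∂(iidLaw ν), Tendsto (fun n : ℕ => (boundaryCount (walk a x) n : ℝ) / (n : ℝ)) atTop
      (𝓝 ((pairLaw ν).real (escapeEvent d))) := by
  classical
  set q := (pairLaw ν).real (escapeEvent d) with hq
  set p : ℕ → ℝ := fun K => (iidLaw ν).real (windowEvent d K) with hp
  have hpq : Tendsto p atTop (𝓝 q) := tendsto_measureReal_windowEvent ν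
  set C : ℝ := (neighbors (0 : Fin d → ℤ)).ncard + 1 with hC
  have hCpos : 0 < C := by positivity
  have hlln : ∀ᵐ x ∂(iidLaw ν), ∀ K : ℕ, 0 < K → Tendsto (fun n : ℕ =>
      (((Finset.range n).filter fun s => shift^[s] x ∈ windowEvent d K).card : ℝ) / n)
      atTop (𝓝 (p K)) := by
    refine ae_all_iff.2 fun K => ?_
    by_cases hK : 0 < K
    · filter_upwards [tendsto_card_shift_mem ν (measurableSet_windowEvent K)
        (by omega : 0 < 2 * K) fun x y => windowEvent_congr] with x hx _ using hx
    · exact ae_of_all _ fun x h => absurd h hK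
  have hlate : ∀ᵐ x ∂(iidLaw ν), q ≠ 0 → ∀ l : ℕ, ∃ K₀, ∀ K ≥ K₀, ∀ n : ℕ,
      (((Finset.range n).filter fun s => shift^[s] x ∈ lateVisit d K).card : ℝ) ≤
        (1 / ((l : ℝ) + 1)) * n := by
    by_cases hq0 : q = 0
    · exact ae_of_all _ fun x h => absurd hq0 h
    have hr : iidLaw ν (noReturn d) ≠ 0 := by
      intro e
      apply hq0
      have := escapeEvent_le_noReturn ν
      rw [e, nonpos_iff_eq_zero] at this
      rw [hq, measureReal_def, this, ENNReal.toReal_zero]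
    filter_upwards [ae_all_iff.2 fun l : ℕ => ae_exists_card_lateVisit_le ν hr
      (c := 1 / ((l : ℝ) + 1)) (by positivity)] with x hx _ using hx
  filter_upwards [hlln, hlate] with x h1 h2
  have hupper : ∀ b, q < b → ∀ᶠ n : ℕ in atTop, (boundaryCount (walk a x) n : ℝ) / n < b := by
    intro b hb
    obtain ⟨K, hKb, hK⟩ := ((hpq.eventually (gt_mem_nhds hb)).and (eventually_gt_atTop 0)).exists
    have hlim := (tendsto_const_div_atTop_nhds_zero_nat ((2 * K : ℕ) : ℝ)).add (h1 K hK)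
    rw [zero_add] at hlim
    filter_upwards [hlim.eventually (gt_mem_nhds hKb)] with n hn
    refine lt_of_le_of_lt ?_ hn
    rw [← add_div]
    exact div_le_div_of_nonneg_right (by exact_mod_cast boundaryCount_le a x hK n)
      (Nat.cast_nonneg n)
  have hlower : ∀ b, b < q → ∀ᶠ n : ℕ in atTop, b < (boundaryCount (walk a x) n : ℝ) / n := by
    intro b hb
    by_cases hq0 : q = 0
    · exact Eventually.of_forall fun n => (hb.trans_eq hq0).trans_le (by positivity)
    -- Half of the gap `q - b` is spent on the window frequency, and a quarter on the late visits.
    obtain ⟨l, hl⟩ := exists_nat_gt (4 * C / (q - b))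
    obtain ⟨K₀, hK₀⟩ := h2 hq0 l
    obtain ⟨K, hKb, hK, hKK⟩ := ((hpq.eventually (lt_mem_nhds (by linarith : (q + b) / 2 < q))).and
      ((eventually_gt_atTop 0).and (eventually_ge_atTop K₀))).exists
    -- The extra `C / (l + 1)` absorbs the count of late visits over `n + 1` times instead of `n`.
    have hlim := (h1 K hK).sub (tendsto_const_div_atTop_nhds_zero_nat
      (((2 * K : ℕ) : ℝ) + C * (1 / ((l : ℝ) + 1))))
    rw [sub_zero] at hlim
    filter_upwards [hlim.eventually (lt_mem_nhds hKb), eventually_gt_atTop 0] with n hn hn0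
    have hnr : (0 : ℝ) < n := by exact_mod_cast hn0
    have hmain : (((Finset.range n).filter fun s => shift^[s] x ∈ windowEvent d K).card : ℝ) ≤
        boundaryCount (walk a x) n + (2 * K : ℕ) + C *
          ((Finset.range (n + 1)).filter fun s => shift^[s] x ∈ lateVisit d K).card := by
      rw [hC]
      exact_mod_cast card_windowEvent_le a x K n
    have hv := mul_le_mul_of_nonneg_left (hK₀ K hKK (n + 1)) hCpos.le
    rw [← sub_div, lt_div_iff₀ hnr] at hn
    have hl' : C * (1 / ((l : ℝ) + 1)) ≤ (q - b) / 4 := by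
      rw [div_lt_iff₀ (by linarith)] at hl
      rw [mul_one_div, div_le_iff₀ (by positivity)]
      nlinarith
    rw [lt_div_iff₀ hnr]
    push_cast at hv hmain hn
    nlinarith [mul_le_mul_of_nonneg_right hl' hnr.le]
  exact tendsto_order.2 ⟨hlower, hupper⟩

end

end RangeBoundary

/-! ### Transfer from sequence space to an arbitrary probability space -/

theorem theorem1 {d : ℕ} (hd : 1 ≤ d) {Ω : Type*} [MeasurableSpace Ω] (P : Measure Ω)
    [IsProbabilityMeasure P] (X : ℕ → Ω → Fin d → ℤ) (hmeas : ∀ i, Measurable (X i))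
    (hindep : iIndepFun X P) (hident : ∀ i, IdentDistrib (X i) (X 0) P P) (a : Fin d → ℤ) :
    ∀ᵐ ω ∂P, Tendsto
      (fun n : ℕ =>
        (RangeBoundary.boundaryCount (RangeBoundary.walk a (fun i => X i ω)) n : ℝ) / (n : ℝ))
      atTop (𝓝 (RangeBoundary.boundaryRate P X)) := by
  have hν : IsProbabilityMeasure (P.map (X 0)) :=
    Measure.isProbabilityMeasure_map (hmeas 0).aemeasurable
  have hX : Measurable fun ω i => X i ω := measurable_pi_lambda _ hmeas
  have hlaw : P.map (fun ω i => X i ω) = RangeBoundary.iidLaw (P.map (X 0)) := by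
    rw [hindep.map_fun_eq_infinitePi_map hmeas, RangeBoundary.iidLaw]
    simp only [fun i => (hident i).map_eq]
  have hrate : RangeBoundary.boundaryRate P X =
      (RangeBoundary.pairLaw (P.map (X 0))).real (RangeBoundary.escapeEvent d) := by
    have hw := RangeBoundary.measurable_walk_path (d := d)
    rw [RangeBoundary.pairLaw, ← hlaw, Measure.map_map hw hX]
    erw [Measure.map_map hw.neg hX]
    rfl
  rw [hrate]
  have h := RangeBoundary.tendsto_boundaryCount_div (P.map (X 0)) a
  rw [← hlaw] at h
  exact ae_of_ae_map hX.aemeasurable h
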